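/- Let $A_2=\mathbb C[t_1,t_2]$, $\partial_i=\partial/\partial t_i$, let $\bar S_2=\{p_1\partial_1+p_2\partial_2 : p_i\in A_2,\ \partial_1(p_1)+\partial_2(p_2)\in\mathbb C\}$ be the Lie algebra of polynomial vector fields with constant divergence, and let $\Delta_2=\mathrm{span}\{\partial_1,\partial_2\}$. Let $\Omega^{\bar S_2}_{\mathbf 0}$ be the category of $\bar S_2$-modules $M$ on which $\Delta_2$ acts locally finitely, on which every $x\in\Delta_2$ acts locally nilpotently, and for which the space $\mathrm{Wh}_{\mathbf 0}(M)=\{v\in M : xv=0\ \ \forall x\in\Delta_2\}$ is finite-dimensional. For a $\mathfrak{gl}_2$-module $V$ (over $\mathbb C$) let $T(A_2,V)=A_2\otimes V$ be the $\bar S_2$-module with $$D(p\otimes v)=D(p)\otimes v+\sum_{i,j=1}^{2}\partial_i(p_j)\,p\otimes E_{ij}v,\qquad D=p_1\partial_1+p_2\partial_2\in\bar S_2,\ p\in A_2,\ v\in V,$$ and let $T_1(A_2,V)$ be its $\bar S_2$-submodule generated by $V=1\otimes V$. Let $\bar S_2(0)=\mathrm{span}\{t_i\partial_j\}\cong\mathfrak{gl}_2$,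 $t_i\partial_j\mapsto E_{ij}$, and let $P(V)=U(\bar S_2)\otimes_{U(\Delta_2\oplus\bar S_2(0))}V$ be the parabolic Verma module, where $\bar S_2(0)$ acts on $V$ through this isomorphism and $\Delta_2V=0$. Proposition 4.1. (1) For every finite-dimensional simple $\mathfrak{gl}_2$-module $V$, the $\bar S_2$-module $T_1(A_2,V)$ is simple, $P(V)$ has a unique simple quotient $L(V)$ (that is, there is exactly one submodule $N$ with $P(V)/N$ simple), and $L(V)\cong T_1(A_2,V)$ as $\bar S_2$-modules. (2) If $M$ is a simple module in $\Omega^{\bar S_2}_{\mathbf 0}$, then there is a finite-dimensional simple $\mathfrak{gl}_2$-module $V$ such that $M\cong T_1(A_2,V)$ as $\bar S_2$-modules (and hence $M\cong L(V)$). -/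

import Mathlib

open scoped TensorProduct

-- Associative rings (matrices, enveloping algebras) carry the commutator bracket.
attribute [local instance 100] LieRing.ofAssociativeRing

universe u

namespace WhittakerS2

/-- The polynomial algebra `A₂ = ℂ[t₁, t₂]`; the variable `tᵢ` is `MvPolynomial.X i`. -/
abbrev A2 : Type := MvPolynomial (Fin 2) ℂ

/-- The Witt algebra `W₂` of derivations of `A₂`. -/
abbrev W2 : Type := Derivation ℂ A2 A2

/-- The Lie algebra `gl₂` of complex `2 × 2` matrices, with the commutator bracket. -/
abbrev gl2 : Type := Matrix (Fin 2) (Fin 2) ℂ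

/-- The Jacobian matrix of `D = ∑ pⱼ ∂ⱼ`: its `(i, j)` entry is `∂ᵢ(pⱼ)`, where `pⱼ = D(tⱼ)`. -/
noncomputable def jac (D : W2) : Matrix (Fin 2) (Fin 2) A2 :=
  Matrix.of fun i j => MvPolynomial.pderiv i (D (MvPolynomial.X j))

/-- The divergence of `D = ∑ pᵢ ∂ᵢ` is `∑ ∂ᵢ(pᵢ)`. -/
noncomputable def divergence (D : W2) : A2 :=
  ∑ i, MvPolynomial.pderiv i (D (MvPolynomial.X i))

theorem apply_eq_sum (D : W2) (f : A2) :
    D f = ∑ k, D (MvPolynomial.X k) * MvPolynomial.pderiv k f := by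
  have h : D = ∑ k, D (MvPolynomial.X k) • (MvPolynomial.pderiv k : W2) := by
    apply MvPolynomial.derivation_ext
    intro i
    fin_cases i <;> simp [Fin.sum_univ_two, Derivation.add_apply, MvPolynomial.pderiv_X]
  conv_lhs => rw [h]
  simp [Fin.sum_univ_two, Derivation.add_apply]

theorem pderiv_comm (i j : Fin 2) (f : A2) :
    MvPolynomial.pderiv i (MvPolynomial.pderiv j f) =
      MvPolynomial.pderiv j (MvPolynomial.pderiv i f) := by
  have h : ⁅(MvPolynomial.pderiv i : W2), (MvPolynomial.pderiv j : W2)⁆ = 0 := by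
    apply MvPolynomial.derivation_ext
    intro k
    simp [Derivation.commutator_apply, MvPolynomial.pderiv_X, Pi.single_apply, apply_ite]
  have h2 := congrArg (fun D : W2 => D f) h
  simpa [Derivation.commutator_apply, sub_eq_zero] using h2

theorem pderiv_apply (D : W2) (j : Fin 2) (f : A2) :
    MvPolynomial.pderiv j (D f) =
      D (MvPolynomial.pderiv j f) + ∑ k, jac D j k * MvPolynomial.pderiv k f := by
  rw [apply_eq_sum D f, apply_eq_sum D (MvPolynomial.pderiv j f)]
  simp only [Fin.sum_univ_two, map_add, Derivation.leibniz, smul_eq_mul, jac, Matrix.of_apply,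
    pderiv_comm j]
  ring

theorem jac_add (D E : W2) : jac (D + E) = jac D + jac E := by
  ext1 i j; simp [jac]

theorem jac_smul (c : ℂ) (D : W2) : jac (c • D) = c • jac D := by
  ext1 i j; simp [jac]

theorem jac_lie (D E : W2) (i j : Fin 2) :
    jac ⁅D, E⁆ i j = D (jac E i j) - E (jac D i j)
      + ∑ k, (jac D i k * jac E k j - jac E i k * jac D k j) := by
  have h : jac ⁅D, E⁆ i j = MvPolynomial.pderiv i (D (E (MvPolynomial.X j)))
      - MvPolynomial.pderiv i (E (D (MvPolynomial.X j))) := by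
    simp [jac, Derivation.commutator_apply]
  rw [h, pderiv_apply D, pderiv_apply E i (D (MvPolynomial.X j))]
  simp only [Fin.sum_univ_two, jac, Matrix.of_apply]
  ring

theorem divergence_eq (D : W2) : divergence D = jac D 0 0 + jac D 1 1 := by
  simp [divergence, jac, Fin.sum_univ_two]

/-- The Lie algebra `S̄₂` of polynomial vector fields with constant divergence. -/
noncomputable def S2bar : LieSubalgebra ℂ W2 where
  carrier := {D | ∃ c : ℂ, divergence D = MvPolynomial.C c}
  add_mem' := by
    rintro D E ⟨c, hc⟩ ⟨c', hc'⟩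
    refine ⟨c + c', ?_⟩
    rw [map_add, ← hc, ← hc']
    simp only [divergence_eq, jac_add, Matrix.add_apply]
    ring
  zero_mem' := ⟨0, by simp [divergence]⟩
  smul_mem' := by
    rintro a D ⟨c, hc⟩
    refine ⟨a * c, ?_⟩
    rw [map_mul, ← hc]
    simp only [divergence_eq, jac_smul, Matrix.smul_apply, MvPolynomial.smul_eq_C_mul]
    ring
  lie_mem' := by
    rintro D E ⟨c, hc⟩ ⟨c', hc'⟩
    refine ⟨0, ?_⟩
    have h1 : D (divergence E) = 0 := by rw [hc', MvPolynomial.derivation_C]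
    have h2 : E (divergence D) = 0 := by rw [hc, MvPolynomial.derivation_C]
    rw [divergence_eq, map_add] at h1 h2
    rw [divergence_eq, jac_lie, jac_lie, map_zero]
    simp only [Fin.sum_univ_two]
    linear_combination h1 - h2

/-- The partial derivative `∂ᵢ` as an element of `S̄₂`. -/
noncomputable def del (i : Fin 2) : S2bar :=
  ⟨MvPolynomial.pderiv i, 0, by
    fin_cases i <;> simp [divergence, Fin.sum_univ_two, MvPolynomial.pderiv_X]⟩

/-- `Δ₂ = span {∂₁, ∂₂}`. -/
noncomputable def Delta2 : Submodule ℂ S2bar := Submodule.span ℂ (Set.range del)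

/-- The linear functional `φ_a` on `Δ₂` with `φ_a(∂ᵢ) = aᵢ`: the coefficient of `∂ᵢ` in
`x ∈ Δ₂` is the constant polynomial `x(tᵢ)`. -/
noncomputable def phi (a : Fin 2 → ℂ) : Delta2 →ₗ[ℂ] ℂ where
  toFun x := ∑ i, a i * MvPolynomial.constantCoeff ((x : S2bar).1 (MvPolynomial.X i))
  map_add' x y := by simp [Fin.sum_univ_two]; ring
  map_smul' c x := by simp [Fin.sum_univ_two, MvPolynomial.smul_eq_C_mul]; ring

theorem phi_del (a : Fin 2 → ℂ) (i : Fin 2) :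
    phi a ⟨del i, Submodule.subset_span ⟨i, rfl⟩⟩ = a i := by
  fin_cases i <;> simp [phi, del, Fin.sum_univ_two, MvPolynomial.pderiv_X]

section Whittaker

variable (M : Type*) [AddCommGroup M] [Module ℂ M] [LieRingModule S2bar M] [LieModule ℂ S2bar M]

/-- The space `Wh_a(M)` of Whittaker vectors: `x v = φ_a(x) v` for all `x ∈ Δ₂`. -/
noncomputable def Wh (a : Fin 2 → ℂ) : Submodule ℂ M where
  carrier := {v | ∀ x : Delta2, ⁅(x : S2bar), v⁆ = phi a x • v}
  add_mem' := by
    intro v w hv hw x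
    rw [lie_add, hv x, hw x, smul_add]
  zero_mem' := by
    intro x
    rw [lie_zero, smul_zero]
  smul_mem' := by
    intro c v hv x
    rw [lie_smul, hv x, smul_comm]

/-- `M` is a Whittaker module: `Δ₂` acts locally finitely. -/
def IsWhittaker : Prop :=
  ∀ v : M, ∃ W : Submodule ℂ M, FiniteDimensional ℂ W ∧ v ∈ W ∧
    ∀ x : Delta2, ∀ w ∈ W, ⁅(x : S2bar), w⁆ ∈ W

/-- `M` is of type `φ_a`: every `x - φ_a(x)`, `x ∈ Δ₂`, acts locally nilpotently on `M`. -/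
def IsOfType (a : Fin 2 → ℂ) : Prop :=
  ∀ (v : M) (x : Delta2), ∃ k : ℕ,
    ((LieModule.toEnd ℂ S2bar M x - phi a x • (1 : Module.End ℂ M)) ^ k) v = 0

/-- `M` is an object of `Ω_a`: a Whittaker `S̄₂`-module of type `φ_a` whose space of Whittaker
vectors is finite-dimensional. -/
structure InOmega (a : Fin 2 → ℂ) : Prop where
  isWhittaker : IsWhittaker M
  isOfType : IsOfType M a
  finiteDimensional : FiniteDimensional ℂ (Wh M a)

end Whittaker

/-- The underlying space `A₂ ⊗ V` of the tensor module `T(A₂, V)`. -/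
def T (V : Type u) [AddCommGroup V] [Module ℂ V] : Type u := A2 ⊗[ℂ] V

section Tensor

variable (V : Type u) [AddCommGroup V] [Module ℂ V]

noncomputable instance : AddCommGroup (T V) := inferInstanceAs (AddCommGroup (A2 ⊗[ℂ] V))
noncomputable instance : Module ℂ (T V) := inferInstanceAs (Module ℂ (A2 ⊗[ℂ] V))

variable [LieRingModule gl2 V] [LieModule ℂ gl2 V]

/-- The action of the vector field `D` on `T(A₂, V) = A₂ ⊗ V`:
`D (p ⊗ v) = D(p) ⊗ v + ∑ᵢⱼ ∂ᵢ(D(tⱼ)) p ⊗ Eᵢⱼ v`. -/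
noncomputable def tensorAct (D : W2) : A2 ⊗[ℂ] V →ₗ[ℂ] A2 ⊗[ℂ] V :=
  TensorProduct.map (D : A2 →ₗ[ℂ] A2) LinearMap.id +
    ∑ i, ∑ j, TensorProduct.map (LinearMap.mulLeft ℂ (jac D i j))
      (LieModule.toEnd ℂ gl2 V (Matrix.single i j 1))

variable {V}

theorem tensorAct_tmul (D : W2) (p : A2) (v : V) :
    tensorAct V D (p ⊗ₜ v) =
      D p ⊗ₜ v + ∑ i, ∑ j, (jac D i j * p) ⊗ₜ ⁅(Matrix.single i j 1 : gl2), v⁆ := by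
  simp [tensorAct]

theorem tensorAct_add (D E : W2) : tensorAct V (D + E) = tensorAct V D + tensorAct V E := by
  refine TensorProduct.ext' fun p v => ?_
  simp only [LinearMap.add_apply, tensorAct_tmul, jac_add, Fin.sum_univ_two,
    Derivation.add_apply, Matrix.add_apply, add_mul, TensorProduct.add_tmul]
  abel

theorem tensorAct_smul (c : ℂ) (D : W2) : tensorAct V (c • D) = c • tensorAct V D := by
  refine TensorProduct.ext' fun p v => ?_
  simp only [LinearMap.smul_apply, tensorAct_tmul, jac_smul, Fin.sum_univ_two,
    Derivation.smul_apply, Matrix.smul_apply, smul_mul_assoc, TensorProduct.smul_tmul', smul_add]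

theorem single_lie (i j k l : Fin 2) (v : V) :
    ⁅(Matrix.single i j 1 : gl2), ⁅(Matrix.single k l 1 : gl2), v⁆⁆ =
      ⁅(Matrix.single k l 1 : gl2), ⁅(Matrix.single i j 1 : gl2), v⁆⁆
      + ((if j = k then ⁅(Matrix.single i l 1 : gl2), v⁆ else 0)
        - (if l = i then ⁅(Matrix.single k j 1 : gl2), v⁆ else 0)) := by
  rw [leibniz_lie, LieRing.of_associative_ring_bracket, add_comm]
  congr 1
  rw [sub_lie]
  congr 1
  · split_ifs with h
    · subst h; simp
    · rw [Matrix.single_mul_single_of_ne (h := h), zero_lie]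
  · split_ifs with h
    · subst h; simp
    · rw [Matrix.single_mul_single_of_ne (h := h), zero_lie]

theorem tensorAct_lie (D E : W2) (w : A2 ⊗[ℂ] V) :
    tensorAct V ⁅D, E⁆ w =
      tensorAct V D (tensorAct V E w) - tensorAct V E (tensorAct V D w) := by
  induction w using TensorProduct.induction_on with
  | zero => simp
  | add x y hx hy => simp only [map_add, hx, hy]; abel
  | tmul p v =>
    have key : ∀ (q : A2) (u : V), q ⊗ₜ[ℂ] u = q • ((1 : A2) ⊗ₜ[ℂ] u) := by
      intro q u
      rw [TensorProduct.smul_tmul', smul_eq_mul, mul_one]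
    have h := single_lie (V := V)
    simp only [tensorAct_tmul, map_add, Fin.sum_univ_two, jac_lie, Derivation.commutator_apply,
      Derivation.leibniz, smul_eq_mul]
    rw [h 0 1 0 0, h 1 0 0 0, h 1 0 0 1, h 1 1 0 0, h 1 1 0 1, h 1 1 1 0]
    simp only [Fin.isValue, if_true, if_false, zero_ne_one, one_ne_zero,
      TensorProduct.tmul_add, TensorProduct.tmul_sub, TensorProduct.tmul_zero]
    simp only [key (_ + _), key (_ - _), key (_ * _), key (D _), key (E _)]
    module

noncomputable instance : LieRingModule S2bar (T V) where
  bracket D w := tensorAct V D.1 w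
  add_lie D E w := LinearMap.congr_fun (tensorAct_add D.1 E.1) w
  lie_add D w w' := map_add (tensorAct V D.1) w w'
  leibniz_lie D E w := by
    have h := tensorAct_lie D.1 E.1 w
    exact (sub_eq_iff_eq_add.mp h.symm)

noncomputable instance : LieModule ℂ S2bar (T V) where
  smul_lie c D w := LinearMap.congr_fun (tensorAct_smul c D.1) w
  lie_smul c D w := map_smul (tensorAct V D.1) c w

variable (V)

/-- `T₁(A₂, V)`: the `S̄₂`-submodule of `T(A₂, V)` generated by `V = 1 ⊗ V`. -/
noncomputable def T1 : LieSubmodule ℂ S2bar (T V) :=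
  LieSubmodule.lieSpan ℂ S2bar (Set.range fun v : V => ((1 : A2) ⊗ₜ[ℂ] v : A2 ⊗[ℂ] V))

end Tensor

/-- The parabolic subalgebra `Δ₂ ⊕ S̄₂(0)`, spanned by the `∂ᵢ` and the `tᵢ ∂ⱼ`: it consists of
the vector fields with affine coefficients, i.e. with constant Jacobian matrix. -/
noncomputable def parabolic : LieSubalgebra ℂ S2bar where
  carrier := {D | ∃ a : gl2, ∀ i j, jac D.1 i j = MvPolynomial.C (a i j)}
  add_mem' := by
    rintro D E ⟨a, ha⟩ ⟨b, hb⟩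
    exact ⟨a + b, fun i j => by simp [jac_add, ha, hb]⟩
  zero_mem' := ⟨0, fun i j => by simp [jac]⟩
  smul_mem' := by
    rintro c D ⟨a, ha⟩
    exact ⟨c • a, fun i j => by simp [jac_smul, ha, MvPolynomial.smul_eq_C_mul]⟩
  lie_mem' := by
    rintro D E ⟨a, ha⟩ ⟨b, hb⟩
    refine ⟨⁅a, b⁆, fun i j => ?_⟩
    rw [LieSubalgebra.coe_bracket, jac_lie]
    simp only [ha, hb, MvPolynomial.derivation_C, Fin.sum_univ_two,
      LieRing.of_associative_ring_bracket, Matrix.sub_apply, Matrix.mul_apply, map_sub, map_add,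
      map_mul]
    ring

/-- The projection `Δ₂ ⊕ S̄₂(0) → S̄₂(0) ≅ gl₂`, killing `Δ₂` and sending `tᵢ ∂ⱼ` to `Eᵢⱼ`;
it is the (constant) Jacobian matrix. -/
noncomputable def levi : parabolic →ₗ⁅ℂ⁆ gl2 where
  toFun D := Matrix.of fun i j => MvPolynomial.constantCoeff (jac D.1.1 i j)
  map_add' D E := by ext i j; simp [jac_add]
  map_smul' c D := by ext i j; simp [jac_smul, MvPolynomial.smul_eq_C_mul]
  map_lie' := by
    rintro ⟨D, a, ha⟩ ⟨E, b, hb⟩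
    ext i j
    simp only [LieSubalgebra.coe_bracket, Matrix.of_apply, jac_lie,
      LieRing.of_associative_ring_bracket, Matrix.sub_apply, Matrix.mul_apply]
    simp only [ha, hb, MvPolynomial.derivation_C, Fin.sum_univ_two, map_sub, map_add, map_mul,
      map_zero, MvPolynomial.constantCoeff_C]
    ring

/-- The enveloping algebra `U(S̄₂)`. -/
abbrev US2 : Type := UniversalEnvelopingAlgebra ℂ S2bar

section Verma

variable (V : Type u) [AddCommGroup V] [Module ℂ V] [LieRingModule gl2 V] [LieModule ℂ gl2 V]

/-- The left `U(S̄₂)`-submodule of `U(S̄₂) ⊗_ℂ V` by which one divides to obtain the tensor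
product over `U(Δ₂ ⊕ S̄₂(0))`. -/
noncomputable def vermaRel : Submodule US2 (US2 ⊗[ℂ] V) :=
  Submodule.span US2 {w | ∃ (x : parabolic) (v : V),
    w = UniversalEnvelopingAlgebra.ι ℂ (x : S2bar) ⊗ₜ v - 1 ⊗ₜ ⁅levi x, v⁆}

/-- The parabolic Verma module `U(S̄₂) ⊗_{U(Δ₂ ⊕ S̄₂(0))} V`, where `S̄₂(0) ≅ gl₂` acts on `V` as
given and `Δ₂ V = 0`. -/
def ParabolicVerma : Type u := (US2 ⊗[ℂ] V) ⧸ vermaRel V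

noncomputable instance : AddCommGroup (ParabolicVerma V) :=
  inferInstanceAs (AddCommGroup ((US2 ⊗[ℂ] V) ⧸ vermaRel V))
noncomputable instance : Module US2 (ParabolicVerma V) :=
  inferInstanceAs (Module US2 ((US2 ⊗[ℂ] V) ⧸ vermaRel V))
noncomputable instance : Module ℂ (ParabolicVerma V) :=
  inferInstanceAs (Module ℂ ((US2 ⊗[ℂ] V) ⧸ vermaRel V))
instance : IsScalarTower ℂ US2 (ParabolicVerma V) :=
  inferInstanceAs (IsScalarTower ℂ US2 ((US2 ⊗[ℂ] V) ⧸ vermaRel V))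

noncomputable instance : LieRingModule S2bar (ParabolicVerma V) where
  bracket x m := UniversalEnvelopingAlgebra.ι ℂ x • m
  add_lie x y m := by
    change UniversalEnvelopingAlgebra.ι ℂ (x + y) • m = _
    rw [map_add, add_smul]
  lie_add x m n := smul_add _ m n
  leibniz_lie x y m := by
    change UniversalEnvelopingAlgebra.ι ℂ x • UniversalEnvelopingAlgebra.ι ℂ y • m =
      UniversalEnvelopingAlgebra.ι ℂ ⁅x, y⁆ • m +
        UniversalEnvelopingAlgebra.ι ℂ y • UniversalEnvelopingAlgebra.ι ℂ x • m
    rw [LieHom.map_lie, LieRing.of_associative_ring_bracket, sub_smul, mul_smul, mul_smul,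
      sub_add_cancel]

instance : LieModule ℂ S2bar (ParabolicVerma V) where
  smul_lie c x m := by
    change UniversalEnvelopingAlgebra.ι ℂ (c • x) • m = c • UniversalEnvelopingAlgebra.ι ℂ x • m
    rw [map_smul, smul_assoc]
  lie_smul c x m := by
    change UniversalEnvelopingAlgebra.ι ℂ x • c • m = c • UniversalEnvelopingAlgebra.ι ℂ x • m
    rw [← smul_assoc c, ← algebraMap_smul US2 c m, smul_smul, ← Algebra.commutes,
      ← Algebra.smul_def]

end Verma

end WhittakerS2

/-!
Grade everything by the Euler field `t₁∂₁ + t₂∂₂`: the field `S̄₂` is the sum of the affine fields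
and of `ad`-eigenvectors of positive degree. Hence a module generated by a copy of `V` killed by
`Δ₂` is the sum of `V`, on which the Euler field acts by a scalar `c`, and of Euler eigenvectors
with eigenvalues in `c + {1, 2, …}`. A proper submodule has no component in degree `c`, so the sum
of two proper submodules is proper and there is only one maximal submodule; in particular `P(V)` has
a unique simple quotient, and any simple module containing such a copy of `V` is that quotient.

On `A₂ ⊗ V` the `∂ᵢ` are commuting and locally nilpotent, with common kernel `1 ⊗ V`. So every
nonzero submodule meets `1 ⊗ V`, hence contains `T₁(A₂, V)`, which is therefore simple. Conversely,
for a simple `M` of type `0` the space `Wh₀(M)` is a nonzero finite-dimensional `gl₂`-module, any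
simple submodule `V` of which generates `M`.
-/

namespace WhittakerS2

section LieModule

variable {R L M M' : Type*} [CommRing R] [LieRing L]
  [AddCommGroup M] [Module R M] [LieRingModule L M]
  [AddCommGroup M'] [Module R M'] [LieRingModule L M']

theorem isIrreducible_of_isAtom {N : LieSubmodule R L M} (hN : IsAtom N) :
    LieModule.IsIrreducible R L N := by
  have : Nontrivial N := (LieSubmodule.nontrivial_iff_ne_bot R L M).mpr hN.1
  refine LieModule.IsIrreducible.mk fun K hK => ?_
  have hinj := LieSubmodule.map_injective_of_injective (f := N.incl) Subtype.coe_injective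
  rcases hN.le_iff.mp (LieSubmodule.map_incl_le (N' := K)) with h | h
  · exact absurd (hinj (h.trans LieSubmodule.map_bot.symm)) hK
  · exact hinj (h.trans N.map_incl_top.symm)

theorem isIrreducible_congr (e : M ≃ₗ⁅R,L⁆ M') :
    LieModule.IsIrreducible R L M ↔ LieModule.IsIrreducible R L M' :=
  (LieSubmodule.orderIsoMapComap e).isSimpleOrder_iff

theorem lieSpan_range_eq_top {V : Type*} [LieModule.IsIrreducible R L M] {f : V → M} {v : V}
    (hv : f v ≠ 0) : LieSubmodule.lieSpan R L (Set.range f) = ⊤ := by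
  refine (eq_bot_or_eq_top _).resolve_left fun h => hv ?_
  have hmem : f v ∈ LieSubmodule.lieSpan R L (Set.range f) := LieSubmodule.subset_lieSpan ⟨v, rfl⟩
  rwa [h, LieSubmodule.mem_bot] at hmem

variable [LieAlgebra R L] [LieModule R L M] [LieModule R L M']

theorem isCoatom_of_isIrreducible_quotient {N : LieSubmodule R L M}
    (h : LieModule.IsIrreducible R L (M ⧸ N)) : IsCoatom N := by
  have hnt := LieModule.nontrivial_of_isIrreducible R L (M ⧸ N)
  refine ⟨?_, fun K hK => ?_⟩
  · rintro rfl
    obtain ⟨a, ha⟩ := exists_ne (0 : M ⧸ (⊤ : LieSubmodule R L M))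
    obtain ⟨m, rfl⟩ := LieSubmodule.Quotient.surjective_mk' _ a
    exact ha ((LieSubmodule.Quotient.mk_eq_zero _).mpr trivial)
  have hmap : K.map (LieSubmodule.Quotient.mk' N) = ⊤ :=
    (eq_bot_or_eq_top _).resolve_left fun h0 =>
      hK.not_ge ((LieSubmodule.Quotient.map_mk'_eq_bot_le _ _).mp h0)
  refine eq_top_iff.mpr fun m _ => ?_
  obtain ⟨k, hk, hkm⟩ := (LieSubmodule.mem_map _).mp (hmap ▸ LieSubmodule.mem_top
    (LieSubmodule.Quotient.mk' N m))
  have hsub : m - k ∈ N := by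
    rw [← LieSubmodule.Quotient.mk_eq_zero, map_sub, hkm, sub_self]
  simpa using K.add_mem (hK.le hsub) hk

/-- The first isomorphism theorem for Lie modules. -/
noncomputable def quotKerEquivRange (φ : M →ₗ⁅R,L⁆ M') : (M ⧸ φ.ker) ≃ₗ⁅R,L⁆ φ.range :=
  { (φ : M →ₗ[R] M').quotKerEquivRange with
    map_lie' := by
      intro x m
      obtain ⟨m, rfl⟩ := LieSubmodule.Quotient.surjective_mk' φ.ker m
      exact Subtype.ext (φ.map_lie x m) }

/-- If `W` is stable under `p`, and `p` and `s` together span `L`, then the Lie submodule generated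
by `W` lies in any `s`-stable subspace containing `W`: no element of `p` has to be applied after
elements of `s`. -/
theorem lieSpan_le_of_sup_span_eq_top {p : Submodule R L} {s : Set L}
    (hps : p ⊔ Submodule.span R s = ⊤) {W C : Submodule R M}
    (hpW : ∀ x ∈ p, ∀ w ∈ W, ⁅x, w⁆ ∈ W) (hWC : W ≤ C) (hsC : ∀ y ∈ s, ∀ m ∈ C, ⁅y, m⁆ ∈ C) :
    (LieSubmodule.lieSpan R L (W : Set M)).toSubmodule ≤ C := by
  let C₀ : Submodule R M := sInf {D | W ≤ D ∧ ∀ y ∈ s, ∀ m ∈ D, ⁅y, m⁆ ∈ D}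
  have hWC₀ : W ≤ C₀ := le_sInf fun D hD => hD.1
  have hsC₀ : ∀ y ∈ s, ∀ m ∈ C₀, ⁅y, m⁆ ∈ C₀ := fun y hy m hm =>
    Submodule.mem_sInf.mpr fun D hD => hD.2 y hy m (Submodule.mem_sInf.mp hm D hD)
  let D : Submodule R M := C₀ ⊓ ⨅ x : L, C₀.comap (LieModule.toEnd R L M x)
  have mem_D {m : M} : m ∈ D ↔ m ∈ C₀ ∧ ∀ x : L, ⁅x, m⁆ ∈ C₀ := by
    simp [D, Submodule.mem_iInf]
  have hWD : W ≤ D := fun w hw => by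
    have hspan : p ⊔ Submodule.span R s ≤
        C₀.comap ((LieModule.toEnd R L M : L →ₗ[R] Module.End R M).flip w) :=
      sup_le (fun x hx => hWC₀ (hpW x hx w hw)) <|
        Submodule.span_le.mpr fun y hy => hsC₀ y hy w (hWC₀ hw)
    exact mem_D.mpr ⟨hWC₀ hw, fun x => hspan (hps ▸ Submodule.mem_top)⟩
  have hsD : ∀ y ∈ s, ∀ m ∈ D, ⁅y, m⁆ ∈ D := fun y hy m hm => by
    rw [mem_D] at hm ⊢
    refine ⟨hm.2 y, fun x => ?_⟩
    rw [leibniz_lie]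
    exact C₀.add_mem (hm.2 _) (hsC₀ y hy _ (hm.2 x))
  have hC₀D : C₀ ≤ D := sInf_le ⟨hWD, hsD⟩
  let N : LieSubmodule R L M := { C₀ with lie_mem := fun hm => (mem_D.mp (hC₀D hm)).2 _ }
  have hN : LieSubmodule.lieSpan R L (W : Set M) ≤ N := LieSubmodule.lieSpan_le.mpr hWC₀
  exact le_trans hN (sInf_le ⟨hWC, hsC⟩ : C₀ ≤ C)

end LieModule

section Schur

variable {K L V : Type*} [Field K] [IsAlgClosed K] [LieRing L] [LieAlgebra K L]
  [AddCommGroup V] [Module K V] [LieRingModule L V] [LieModule K L V]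

theorem exists_lie_eq_smul_of_mem_center [FiniteDimensional K V] [LieModule.IsIrreducible K L V]
    {z : L} (hz : z ∈ LieAlgebra.center K L) : ∃ c : K, ∀ v : V, ⁅z, v⁆ = c • v := by
  have := LieModule.nontrivial_of_isIrreducible K L V
  obtain ⟨c, hc⟩ := Module.End.exists_eigenvalue (LieModule.toEnd K L V z)
  let E : LieSubmodule K L V :=
    { Module.End.eigenspace (LieModule.toEnd K L V z) c with
      lie_mem := by
        intro x m hm
        have hm : ⁅z, m⁆ = c • m := Module.End.mem_eigenspace_iff.mp hm
        refine Module.End.mem_eigenspace_iff.mpr ?_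
        rw [LieModule.toEnd_apply_apply, leibniz_lie, hm, lie_smul, ← lie_skew,
          (LieModule.mem_maxTrivSubmodule K L L z).mp hz, neg_zero, zero_lie, zero_add] }
  have hE : E = ⊤ := (eq_bot_or_eq_top E).resolve_left fun h =>
    hc (congrArg LieSubmodule.toSubmodule h)
  exact ⟨c, fun v => Module.End.mem_eigenspace_iff.mp (hE ▸ LieSubmodule.mem_top v : v ∈ E)⟩

end Schur

section LinearAlgebra

theorem mem_of_mem_eigenspace_of_add_mem {K M : Type*} [Field K] [AddCommGroup M] [Module K M]
    {φ : Module.End K M} {N : Submodule K M} (hN : N ≤ N.comap φ) {c : K} {x u : M}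
    (hx : x ∈ φ.eigenspace c) (hu : u ∈ ⨆ μ ≠ c, φ.eigenspace μ) (hxu : x + u ∈ N) : x ∈ N := by
  let ψ : Module.End K (M ⧸ N) := N.mapQ N φ hN
  have mkQ_mem (μ : K) : φ.eigenspace μ ≤ (ψ.eigenspace μ).comap N.mkQ := fun m hm => by
    rw [Module.End.mem_eigenspace_iff] at hm
    simp only [Submodule.mem_comap, Module.End.mem_eigenspace_iff, ψ, Submodule.mkQ_apply,
      Submodule.mapQ_apply, hm, Submodule.Quotient.mk_smul]
  have hu' : N.mkQ u ∈ ⨆ μ ≠ c, ψ.eigenspace μ := by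
    have hle : ⨆ μ ≠ c, φ.eigenspace μ ≤ (⨆ μ ≠ c, ψ.eigenspace μ).comap N.mkQ :=
      iSup₂_le fun μ hμ => (mkQ_mem μ).trans <|
        Submodule.comap_mono (le_iSup₂_of_le μ hμ le_rfl)
    exact hle hu
  have hx' : N.mkQ x = -N.mkQ u := by
    rw [← add_eq_zero_iff_eq_neg, ← map_add]
    exact (Submodule.Quotient.mk_eq_zero N).mpr hxu
  have hzero : N.mkQ x = 0 := Submodule.disjoint_def.mp (ψ.eigenspaces_iSupIndep c) _
    (mkQ_mem c hx) (hx' ▸ Submodule.neg_mem _ hu')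
  exact (Submodule.Quotient.mk_eq_zero N).mp hzero

variable {R M : Type*} [CommRing R] [AddCommGroup M] [Module R M]

theorem inf_ker_ne_bot {f : Module.End R M} {N : Submodule R M} (hf : ∀ m ∈ N, ∃ k, (f ^ k) m = 0)
    (hN : N ≠ ⊥) (hfN : N ≤ N.comap f) : N ⊓ LinearMap.ker f ≠ ⊥ := by
  intro h
  have hpow : ∀ k : ℕ, ∀ m ∈ N, (f ^ k) m = 0 → m = 0 := by
    intro k
    induction k with
    | zero => exact fun m _ hm => hm
    | succ k ih =>
      intro m hm hk
      rw [pow_succ, Module.End.mul_apply] at hk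
      exact (Submodule.eq_bot_iff _).mp h m ⟨hm, ih _ (hfN hm) hk⟩
  refine hN ((Submodule.eq_bot_iff N).mpr fun m hm => ?_)
  obtain ⟨k, hk⟩ := hf m hm
  exact hpow k m hm hk

theorem exists_mem_ne_zero_of_commute {f g : Module.End R M} (hfg : Commute f g)
    {N : Submodule R M} (hf : ∀ m ∈ N, ∃ k, (f ^ k) m = 0) (hg : ∀ m ∈ N, ∃ k, (g ^ k) m = 0)
    (hN : N ≠ ⊥) (hfN : N ≤ N.comap f) (hgN : N ≤ N.comap g) :
    ∃ m ∈ N, m ≠ 0 ∧ f m = 0 ∧ g m = 0 := by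
  have hstable : N ⊓ LinearMap.ker f ≤ (N ⊓ LinearMap.ker f).comap g := fun m hm => by
    refine ⟨hgN hm.1, ?_⟩
    change f (g m) = 0
    rw [← Module.End.mul_apply, hfg.eq, Module.End.mul_apply, LinearMap.mem_ker.mp hm.2, map_zero]
  obtain ⟨m, hm, h0⟩ := Submodule.exists_mem_ne_zero_of_ne_bot <|
    inf_ker_ne_bot (N := N ⊓ LinearMap.ker f) (fun m hm => hg m hm.1) (inf_ker_ne_bot hf hN hfN)
      hstable
  exact ⟨m, hm.1.1, h0, hm.1.2, hm.2⟩

end LinearAlgebra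

section Polynomial

variable {σ R : Type*} [CommSemiring R]

theorem eq_C_of_pderiv_eq_zero [NoZeroDivisors R] [CharZero R] {p : MvPolynomial σ R}
    (h : ∀ i, MvPolynomial.pderiv i p = 0) :
    p = MvPolynomial.C (MvPolynomial.constantCoeff p) := by
  classical
  ext m
  rw [MvPolynomial.coeff_C]
  split_ifs with hm
  · rw [← hm, MvPolynomial.constantCoeff_eq]
  · obtain ⟨i, hi⟩ : ∃ i, m i ≠ 0 := by
      by_contra! hc
      exact hm (Finsupp.ext fun i => (hc i).symm)
    have hcancel : m - Finsupp.single i 1 + Finsupp.single i 1 = m :=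
      tsub_add_cancel_of_le (Finsupp.single_le_iff.mpr (Nat.one_le_iff_ne_zero.mpr hi))
    have hcoeff := congrArg (MvPolynomial.coeff (m - Finsupp.single i 1)) (h i)
    rw [MvPolynomial.coeff_pderiv, hcancel, MvPolynomial.coeff_zero] at hcoeff
    exact (mul_eq_zero.mp hcoeff).resolve_right (Nat.cast_add_one_ne_zero _)

theorem pderiv_homogeneousComponent (n : ℕ) (i : σ) (p : MvPolynomial σ R) :
    MvPolynomial.pderiv i (MvPolynomial.homogeneousComponent (n + 1) p) =
      MvPolynomial.homogeneousComponent n (MvPolynomial.pderiv i p) := by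
  ext m
  simp only [MvPolynomial.coeff_pderiv, MvPolynomial.coeff_homogeneousComponent, map_add,
    Finsupp.degree_single, add_left_inj]
  split_ifs <;> simp

theorem pderiv_pow_monomial_eq_zero (i : σ) {n : ℕ} {s : σ →₀ ℕ} (hs : s i < n) (a : R) :
    ((MvPolynomial.pderiv i).toLinearMap ^ n) (MvPolynomial.monomial s a) = 0 := by
  induction n generalizing s a with
  | zero => exact absurd hs (Nat.not_lt_zero _)
  | succ n ih =>
    rw [pow_succ, Module.End.mul_apply, Derivation.coeFn_coe, MvPolynomial.pderiv_monomial]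
    rcases Nat.eq_zero_or_pos (s i) with h | h
    · simp [h]
    · exact ih (by
        simp only [Finsupp.coe_tsub, Pi.sub_apply, Finsupp.single_eq_same]
        omega) _

theorem pderiv_pow_eq_zero {i : σ} {n : ℕ} {p : MvPolynomial σ R} (hp : p.degreeOf i < n) :
    ((MvPolynomial.pderiv i).toLinearMap ^ n) p = 0 := by
  rw [p.as_sum, map_sum]
  exact Finset.sum_eq_zero fun s hs =>
    pderiv_pow_monomial_eq_zero i ((MvPolynomial.monomial_le_degreeOf i hs).trans_lt hp) _

end Polynomial

section VectorField

theorem coe_del (i : Fin 2) : (del i : W2) = MvPolynomial.pderiv i := rfl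

theorem jac_del (i : Fin 2) : jac (del i : W2) = 0 := by
  ext1 k j
  simp [jac, coe_del, MvPolynomial.pderiv_X, Pi.single_apply, apply_ite]

theorem jac_mkDerivation (p : Fin 2 → A2) (i j : Fin 2) :
    jac (MvPolynomial.mkDerivation ℂ p) i j = MvPolynomial.pderiv i (p j) := by
  rw [jac, Matrix.of_apply, MvPolynomial.mkDerivation_X]

/-- The linear vector field `∑ aᵢⱼ tᵢ ∂ⱼ` attached to a matrix. -/
noncomputable def linearField (a : gl2) : W2 :=
  MvPolynomial.mkDerivation ℂ fun j => ∑ i, MvPolynomial.C (a i j) * MvPolynomial.X i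

theorem linearField_X (a : gl2) (j : Fin 2) :
    linearField a (MvPolynomial.X j) = ∑ i, MvPolynomial.C (a i j) * MvPolynomial.X i :=
  MvPolynomial.mkDerivation_X _ _ _

theorem jac_linearField (a : gl2) (i j : Fin 2) :
    jac (linearField a) i j = MvPolynomial.C (a i j) := by
  rw [linearField, jac_mkDerivation]
  fin_cases i <;> simp [Fin.sum_univ_two, MvPolynomial.pderiv_X]

/-- The isomorphism of `gl₂` onto the algebra `S̄₂(0) ⊆ S̄₂` of linear vector fields. -/
noncomputable def linear : gl2 →ₗ⁅ℂ⁆ S2bar where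
  toFun a := ⟨linearField a, a 0 0 + a 1 1, by simp [divergence_eq, jac_linearField]⟩
  map_add' a b := Subtype.ext <| MvPolynomial.derivation_ext fun j => by
    simp only [linearField_X, Matrix.add_apply, MvPolynomial.C_add, Fin.sum_univ_two,
      AddMemClass.coe_add, Derivation.coe_add, Pi.add_apply]
    ring
  map_smul' c a := Subtype.ext <| MvPolynomial.derivation_ext fun j => by
    simp only [linearField_X, Matrix.smul_apply, smul_eq_mul, MvPolynomial.C_mul,
      Fin.sum_univ_two, RingHom.id_apply, SetLike.val_smul, Derivation.coe_smul, Pi.smul_apply,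
      smul_add, MvPolynomial.smul_eq_C_mul]
    ring
  map_lie' {a b} := Subtype.ext <| MvPolynomial.derivation_ext fun j => by
    simp only [LieRing.of_associative_ring_bracket, linearField_X, Matrix.sub_apply,
      Matrix.mul_apply, Fin.sum_univ_two, MvPolynomial.C_sub, MvPolynomial.C_mul,
      LieSubalgebra.coe_bracket, Derivation.commutator_apply, map_add, Derivation.leibniz,
      smul_eq_mul, MvPolynomial.derivation_C, mul_zero, add_zero]
    ring

theorem coe_linear (a : gl2) : (linear a : W2) = linearField a := rfl

theorem linear_mem_parabolic (a : gl2) : linear a ∈ parabolic := ⟨a, jac_linearField a⟩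

theorem levi_linear (a : gl2) : levi ⟨linear a, linear_mem_parabolic a⟩ = a := by
  ext i j
  simp [levi, coe_linear, jac_linearField]

theorem jac_eq_C_levi (x : parabolic) (i j : Fin 2) :
    jac (x : S2bar).1 i j = MvPolynomial.C (levi x i j) := by
  obtain ⟨a, ha⟩ := x.2
  simp [levi, ha]

theorem exists_eq_sum_del_add_linear (x : parabolic) :
    ∃ b : Fin 2 → ℂ, (x : S2bar) = ∑ i, b i • del i + linear (levi x) := by
  have hconst (j : Fin 2) : ∃ c, (x : S2bar).1 (MvPolynomial.X j) -
      linearField (levi x) (MvPolynomial.X j) = MvPolynomial.C c := by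
    refine ⟨_, eq_C_of_pderiv_eq_zero fun i => ?_⟩
    have hjac := (jac_eq_C_levi x i j).trans (jac_linearField (levi x) i j).symm
    rwa [map_sub, sub_eq_zero]
  choose b hb using hconst
  refine ⟨b, Subtype.ext <| MvPolynomial.derivation_ext fun j => ?_⟩
  rw [sub_eq_iff_eq_add.mp (hb j)]
  fin_cases j <;>
    simp [Fin.sum_univ_two, coe_del, coe_linear, MvPolynomial.pderiv_X,
      MvPolynomial.smul_eq_C_mul]

theorem del_lie_del (i j : Fin 2) : ⁅del i, del j⁆ = 0 :=
  Subtype.ext <| MvPolynomial.derivation_ext fun k => by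
    change ⁅(MvPolynomial.pderiv i : W2), (MvPolynomial.pderiv j : W2)⁆ (MvPolynomial.X k) = 0
    rw [Derivation.commutator_apply, pderiv_comm, sub_self]

theorem del_lie_linear (i : Fin 2) (a : gl2) : ⁅del i, linear a⁆ = ∑ j, a i j • del j :=
  Subtype.ext <| MvPolynomial.derivation_ext fun k => by
    fin_cases i <;> fin_cases k <;>
      simp [Fin.sum_univ_two, coe_del, coe_linear, linearField_X, Derivation.commutator_apply,
        MvPolynomial.pderiv_X, MvPolynomial.smul_eq_C_mul]

/-- The Euler vector field `∑ tᵢ ∂ᵢ`, whose adjoint action grades `S̄₂`. -/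
noncomputable def euler : S2bar := linear 1

theorem euler_apply_X (i : Fin 2) : (euler : W2) (MvPolynomial.X i) = MvPolynomial.X i := by
  simp [euler, coe_linear, linearField_X, Matrix.one_apply]

theorem euler_apply_of_isHomogeneous {n : ℕ} {p : A2} (hp : p.IsHomogeneous n) :
    (euler : W2) p = (n : ℂ) • p := by
  rw [apply_eq_sum]
  simp only [euler_apply_X]
  rw [hp.sum_X_mul_pderiv, Nat.cast_smul_eq_nsmul]

/-- The part of a vector field whose coefficients are homogeneous of degree `n`; its degree for the
Euler field is `n - 1`. -/
noncomputable def component (n : ℕ) (D : W2) : W2 :=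
  MvPolynomial.mkDerivation ℂ fun j =>
    MvPolynomial.homogeneousComponent n (D (MvPolynomial.X j))

theorem component_X (n : ℕ) (D : W2) (j : Fin 2) : component n D (MvPolynomial.X j) =
    MvPolynomial.homogeneousComponent n (D (MvPolynomial.X j)) :=
  MvPolynomial.mkDerivation_X _ _ _

theorem jac_component_zero (D : W2) : jac (component 0 D) = 0 := by
  ext1 i j
  simp [component, jac_mkDerivation, MvPolynomial.homogeneousComponent_zero]

theorem jac_component_succ (n : ℕ) (D : W2) (i j : Fin 2) :
    jac (component (n + 1) D) i j = MvPolynomial.homogeneousComponent n (jac D i j) := by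
  rw [component, jac_mkDerivation, pderiv_homogeneousComponent, jac, Matrix.of_apply]

theorem component_mem_S2bar (n : ℕ) {D : W2} (hD : D ∈ S2bar) : component n D ∈ S2bar := by
  obtain ⟨c, hc⟩ := hD
  rcases n with _ | _ | n
  · exact ⟨0, by simp [divergence_eq, jac_component_zero]⟩
  · refine ⟨c, ?_⟩
    rw [divergence_eq, jac_component_succ, jac_component_succ, ← map_add, ← divergence_eq, hc]
    simp [MvPolynomial.homogeneousComponent_zero]
  · refine ⟨0, ?_⟩
    rw [divergence_eq, jac_component_succ, jac_component_succ, ← map_add, ← divergence_eq, hc,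
      MvPolynomial.homogeneousComponent_eq_zero _ _ (by simp), map_zero]

theorem component_mem_parabolic {n : ℕ} (hn : n ≤ 1) (x : S2bar) :
    (⟨component n x.1, component_mem_S2bar n x.2⟩ : S2bar) ∈ parabolic := by
  interval_cases n
  · exact ⟨0, fun i j => by simp [jac_component_zero]⟩
  · refine ⟨Matrix.of fun i j => MvPolynomial.coeff 0 (jac x.1 i j), fun i j => ?_⟩
    rw [jac_component_succ, MvPolynomial.homogeneousComponent_zero, Matrix.of_apply]

theorem euler_lie_component (n : ℕ) (D : W2) :
    ⁅(euler : W2), component n D⁆ = ((n : ℂ) - 1) • component n D :=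
  MvPolynomial.derivation_ext fun j => by
    rw [Derivation.commutator_apply, euler_apply_X, Derivation.smul_apply, component_X,
      euler_apply_of_isHomogeneous (MvPolynomial.homogeneousComponent_isHomogeneous n _), sub_smul,
      one_smul]

theorem exists_eq_sum_component (x : S2bar) :
    ∃ N, x = ∑ n ∈ Finset.range N, ⟨component n x.1, component_mem_S2bar n x.2⟩ := by
  let N := Finset.univ.sup (fun j : Fin 2 => (x.1 (MvPolynomial.X j)).totalDegree) + 1
  refine ⟨N, Subtype.ext <| MvPolynomial.derivation_ext fun j => ?_⟩
  let evalX : S2bar →+ A2 :=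
    (Pi.evalAddMonoidHom (fun _ : A2 => A2) (MvPolynomial.X j)).comp
      (Derivation.coeFnAddMonoidHom.comp S2bar.toSubmodule.subtype.toAddMonoidHom)
  have hdeg : (x.1 (MvPolynomial.X j)).totalDegree + 1 ≤ N :=
    Nat.succ_le_succ (Finset.le_sup (f := fun j => (x.1 (MvPolynomial.X j)).totalDegree)
      (Finset.mem_univ j))
  change _ = evalX (∑ n ∈ Finset.range N, _)
  rw [map_sum]
  change _ = ∑ n ∈ Finset.range N, component n x.1 (MvPolynomial.X j)
  simp only [component_X]
  conv_lhs => rw [← MvPolynomial.sum_homogeneousComponent (x.1 (MvPolynomial.X j))]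
  refine Finset.sum_subset (Finset.range_subset_range.mpr hdeg) fun n _ hn => ?_
  exact MvPolynomial.homogeneousComponent_eq_zero _ _ (by simpa using hn)

theorem parabolic_sup_span_eq_top :
    parabolic.toSubmodule ⊔
      Submodule.span ℂ {y : S2bar | ∃ n : ℕ, ⁅euler, y⁆ = ((n : ℂ) + 1) • y} = ⊤ := by
  refine eq_top_iff.mpr fun x _ => ?_
  obtain ⟨N, hN⟩ := exists_eq_sum_component x
  rw [hN]
  refine Submodule.sum_mem _ fun n _ => ?_
  rcases Nat.lt_or_ge 1 n with hn | hn
  · obtain ⟨k, rfl⟩ := Nat.exists_eq_add_of_le hn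
    refine Submodule.mem_sup_right (Submodule.subset_span ⟨k, Subtype.ext ?_⟩)
    refine (euler_lie_component _ x.1).trans (congrArg (· • component _ x.1) ?_)
    push_cast
    ring
  · exact Submodule.mem_sup_left (component_mem_parabolic hn x)

end VectorField

section ParabolicMap

variable {V : Type*} [AddCommGroup V] [Module ℂ V] [LieRingModule gl2 V]
  {M : Type*} [AddCommGroup M] [Module ℂ M] [LieRingModule S2bar M]

/-- `f : V → M` is a homomorphism over the parabolic subalgebra `Δ₂ ⊕ S̄₂(0)`, where `Δ₂` acts on
`V` by zero and `S̄₂(0) ≅ gl₂` as given. -/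
def IsParabolicMap (f : V →ₗ[ℂ] M) : Prop :=
  ∀ (x : parabolic) (v : V), ⁅(x : S2bar), f v⁆ = f ⁅levi x, v⁆

variable {f : V →ₗ[ℂ] M}

theorem IsParabolicMap.lie_linear (hf : IsParabolicMap f) (a : gl2) (v : V) :
    ⁅linear a, f v⁆ = f ⁅a, v⁆ := by
  have h := hf ⟨linear a, linear_mem_parabolic a⟩ v
  rwa [levi_linear] at h

theorem IsParabolicMap.lieSpan_le [LieModule ℂ gl2 V] [LieModule.IsIrreducible ℂ gl2 V]
    (hf : IsParabolicMap f) {N : LieSubmodule ℂ S2bar M} {v : V} (hv : f v ∈ N) (hv0 : v ≠ 0) :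
    LieSubmodule.lieSpan ℂ S2bar (Set.range f) ≤ N := by
  let K : LieSubmodule ℂ gl2 V :=
    { N.toSubmodule.comap f with
      lie_mem := fun {a w} hw => by
        change f ⁅a, w⁆ ∈ N
        rw [← hf.lie_linear]
        exact N.lie_mem hw }
  have hvK : v ∈ K := hv
  have hK : K = ⊤ := (eq_bot_or_eq_top K).resolve_left fun h =>
    hv0 ((LieSubmodule.mem_bot v).mp (h ▸ hvK))
  rw [LieSubmodule.lieSpan_le]
  rintro _ ⟨w, rfl⟩
  exact (hK ▸ LieSubmodule.mem_top w : w ∈ K)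

variable [LieModule ℂ S2bar M]

theorem isParabolicMap_of_del_of_linear (hdel : ∀ i v, ⁅del i, f v⁆ = 0)
    (hlinear : ∀ a v, ⁅linear a, f v⁆ = f ⁅a, v⁆) : IsParabolicMap f := by
  intro x v
  obtain ⟨b, hb⟩ := exists_eq_sum_del_add_linear x
  rw [hb]
  simp [Fin.sum_univ_two, hdel, hlinear]

theorem lie_mem_eigenspace_euler {y : S2bar} {a b : ℂ} {m : M} (hy : ⁅euler, y⁆ = a • y)
    (hm : m ∈ (LieModule.toEnd ℂ S2bar M euler).eigenspace b) :
    ⁅y, m⁆ ∈ (LieModule.toEnd ℂ S2bar M euler).eigenspace (a + b) := by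
  rw [Module.End.mem_eigenspace_iff, LieModule.toEnd_apply_apply] at hm ⊢
  rw [leibniz_lie, hy, hm, smul_lie, lie_smul, ← add_smul]

section Scalar

variable {c : ℂ} (hc : ∀ v : V, ⁅(1 : gl2), v⁆ = c • v)
include hc

theorem IsParabolicMap.range_le_eigenspace (hf : IsParabolicMap f) :
    LinearMap.range f ≤ (LieModule.toEnd ℂ S2bar M euler).eigenspace c := by
  rintro _ ⟨v, rfl⟩
  rw [Module.End.mem_eigenspace_iff, LieModule.toEnd_apply_apply, euler, hf.lie_linear, hc,
    map_smul]

theorem IsParabolicMap.range_sup_eq_top (hf : IsParabolicMap f)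
    (hgen : LieSubmodule.lieSpan ℂ S2bar (Set.range f) = ⊤) :
    LinearMap.range f ⊔ ⨆ μ ≠ c, (LieModule.toEnd ℂ S2bar M euler).eigenspace μ = ⊤ := by
  let E := (LieModule.toEnd ℂ S2bar M euler).eigenspace
  let U : Submodule ℂ M := ⨆ n : ℕ, E (n + 1 + c)
  have le_U (n : ℕ) : E (n + 1 + c) ≤ U := le_iSup (fun n : ℕ => E (n + 1 + c)) n
  have hU : U ≤ ⨆ μ ≠ c, E μ := iSup_le fun n => le_iSup₂_of_le ((n : ℂ) + 1 + c)
    (fun h => Nat.cast_add_one_ne_zero n (add_eq_right.mp h)) le_rfl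
  suffices h : (LieSubmodule.lieSpan ℂ S2bar (Set.range f)).toSubmodule ≤ LinearMap.range f ⊔ U by
    rw [hgen, LieSubmodule.top_toSubmodule, top_le_iff] at h
    exact top_le_iff.mp (h.symm.trans_le (sup_le_sup_left hU _))
  refine lieSpan_le_of_sup_span_eq_top (W := LinearMap.range f) parabolic_sup_span_eq_top ?_
    le_sup_left ?_
  · rintro x hx _ ⟨v, rfl⟩
    exact ⟨_, (hf ⟨x, hx⟩ v).symm⟩
  · rintro y ⟨n, hn⟩ m hm
    refine Submodule.mem_sup_right ?_
    suffices h : LinearMap.range f ⊔ U ≤ U.comap (LieModule.toEnd ℂ S2bar M y) from h hm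
    refine sup_le (fun m hm => le_U n ?_) (iSup_le fun k m hm => le_U (n + 1 + k) ?_)
    · exact lie_mem_eigenspace_euler hn (hf.range_le_eigenspace hc hm)
    · have hdeg : ((n + 1 + k : ℕ) : ℂ) + 1 + c = n + 1 + (k + 1 + c) := by
        push_cast
        ring
      exact hdeg ▸ lie_mem_eigenspace_euler hn hm

theorem IsParabolicMap.le_iSup_eigenspace [LieModule ℂ gl2 V] [LieModule.IsIrreducible ℂ gl2 V]
    (hf : IsParabolicMap f) (hgen : LieSubmodule.lieSpan ℂ S2bar (Set.range f) = ⊤)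
    {N : LieSubmodule ℂ S2bar M} (hN : N ≠ ⊤) :
    N.toSubmodule ≤ ⨆ μ ≠ c, (LieModule.toEnd ℂ S2bar M euler).eigenspace μ := by
  intro m hm
  obtain ⟨_, ⟨v, rfl⟩, u, hu, rfl⟩ :=
    Submodule.mem_sup.mp (hf.range_sup_eq_top hc hgen ▸ Submodule.mem_top (x := m))
  have hv : f v ∈ N := mem_of_mem_eigenspace_of_add_mem (fun _ h => N.lie_mem h)
    (hf.range_le_eigenspace hc ⟨v, rfl⟩) hu hm
  have hv0 : v = 0 := by
    by_contra hv0
    exact hN (eq_top_iff.mpr (hgen ▸ hf.lieSpan_le hv hv0))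
  rwa [hv0, map_zero, zero_add]

theorem IsParabolicMap.iSup_eigenspace_ne_top [Nontrivial M] (hf : IsParabolicMap f)
    (hgen : LieSubmodule.lieSpan ℂ S2bar (Set.range f) = ⊤) :
    ⨆ μ ≠ c, (LieModule.toEnd ℂ S2bar M euler).eigenspace μ ≠ ⊤ := by
  intro h
  have hzero : (LieModule.toEnd ℂ S2bar M euler).eigenspace c = ⊥ := by
    have hdisj := (LieModule.toEnd ℂ S2bar M euler).eigenspaces_iSupIndep c
    rwa [h, disjoint_top] at hdisj
  refine top_ne_bot (α := LieSubmodule ℂ S2bar M) (hgen.symm.trans (eq_bot_iff.mpr ?_))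
  exact LieSubmodule.lieSpan_le.mpr fun m hm =>
    (Submodule.mem_bot ℂ).mp (hzero ▸ hf.range_le_eigenspace hc hm)

end Scalar

theorem one_mem_center : (1 : gl2) ∈ LieAlgebra.center ℂ gl2 :=
  (LieModule.mem_maxTrivSubmodule ℂ gl2 gl2 1).mpr fun a => by
    rw [LieRing.of_associative_ring_bracket, mul_one, one_mul, sub_self]

theorem IsParabolicMap.isCoatom_unique [LieModule ℂ gl2 V] [FiniteDimensional ℂ V]
    [LieModule.IsIrreducible ℂ gl2 V] (hf : IsParabolicMap f)
    (hgen : LieSubmodule.lieSpan ℂ S2bar (Set.range f) = ⊤)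
    {N N' : LieSubmodule ℂ S2bar M} (hN : IsCoatom N) (hN' : IsCoatom N') : N = N' := by
  obtain ⟨c, hc⟩ := exists_lie_eq_smul_of_mem_center (V := V) one_mem_center
  have : Nontrivial M := (LieSubmodule.nontrivial_iff ℂ S2bar M).mp ⟨N, ⊤, hN.1⟩
  by_contra hne
  have htop : (N ⊔ N').toSubmodule = ⊤ := by
    rw [hN.sup_eq_top_of_ne hN' hne, LieSubmodule.top_toSubmodule]
  rw [LieSubmodule.sup_toSubmodule] at htop
  exact hf.iSup_eigenspace_ne_top hc hgen <| top_le_iff.mp <| htop.symm.trans_le <|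
    sup_le (hf.le_iSup_eigenspace hc hgen hN.1) (hf.le_iSup_eigenspace hc hgen hN'.1)

end ParabolicMap

section Verma

theorem adjoin_range_ι_eq_top (R L : Type*) [CommRing R] [LieRing L] [LieAlgebra R L] :
    Algebra.adjoin R (Set.range (UniversalEnvelopingAlgebra.ι R : L → _)) = ⊤ := by
  let S := Algebra.adjoin R (Set.range (UniversalEnvelopingAlgebra.ι R : L → _))
  let g : L →ₗ⁅R⁆ S :=
    { (UniversalEnvelopingAlgebra.ι R : L →ₗ⁅R⁆ _).toLinearMap.codRestrict
        S.toSubmodule (fun x => Algebra.subset_adjoin ⟨x, rfl⟩) with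
      map_lie' := fun {x y} => Subtype.ext (LieHom.map_lie (UniversalEnvelopingAlgebra.ι R) x y) }
  have hid : S.val.comp (UniversalEnvelopingAlgebra.lift R g) = AlgHom.id R _ := by
    ext x
    exact congrArg Subtype.val (UniversalEnvelopingAlgebra.lift_ι_apply R g x)
  refine eq_top_iff.mpr fun u _ => ?_
  have hu : (UniversalEnvelopingAlgebra.lift R g u : UniversalEnvelopingAlgebra R L) = u :=
    DFunLike.congr_fun hid u
  exact hu ▸ (UniversalEnvelopingAlgebra.lift R g u).2

variable {V : Type u} [AddCommGroup V] [Module ℂ V] [LieRingModule gl2 V]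

theorem smul_mem_of_lieSubmodule
    (N : LieSubmodule ℂ S2bar (ParabolicVerma V)) (u : US2) {m : ParabolicVerma V} (hm : m ∈ N) :
    u • m ∈ N := by
  have hu : u ∈ Algebra.adjoin ℂ (Set.range (UniversalEnvelopingAlgebra.ι ℂ : S2bar → US2)) :=
    adjoin_range_ι_eq_top ℂ S2bar ▸ Algebra.mem_top
  induction hu using Algebra.adjoin_induction generalizing m with
  | mem _ hx =>
    obtain ⟨x, rfl⟩ := hx
    exact N.lie_mem (x := x) hm
  | algebraMap c => rw [algebraMap_smul]; exact N.smul_mem c hm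
  | add a b _ _ ha hb => rw [add_smul]; exact N.add_mem (ha hm) (hb hm)
  | mul a b _ _ ha hb => rw [mul_smul]; exact ha (hb hm)

variable (V)

/-- The quotient map `U(S̄₂) ⊗ V → P(V)`. -/
noncomputable def vermaMk : (US2 ⊗[ℂ] V) →ₗ[US2] ParabolicVerma V := (vermaRel V).mkQ

/-- The map `V → P(V)`, `v ↦ 1 ⊗ v`. -/
noncomputable def vermaMap : V →ₗ[ℂ] ParabolicVerma V :=
  ((vermaMk V).restrictScalars ℂ).comp (TensorProduct.mk ℂ US2 V 1)

theorem smul_vermaMap (u : US2) (v : V) : u • vermaMap V v = vermaMk V (u ⊗ₜ v) := by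
  change u • vermaMk V (1 ⊗ₜ v) = _
  rw [← map_smul, TensorProduct.smul_tmul', smul_eq_mul, mul_one]

theorem isParabolicMap_vermaMap : IsParabolicMap (vermaMap V) := by
  intro x v
  change UniversalEnvelopingAlgebra.ι ℂ (x : S2bar) • vermaMap V v = vermaMk V (1 ⊗ₜ ⁅levi x, v⁆)
  rw [smul_vermaMap, ← sub_eq_zero, ← map_sub]
  exact (Submodule.Quotient.mk_eq_zero _).mpr (Submodule.subset_span ⟨x, v, rfl⟩)

theorem lieSpan_range_vermaMap :
    LieSubmodule.lieSpan ℂ S2bar (Set.range (vermaMap V)) = ⊤ := by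
  refine eq_top_iff.mpr fun m _ => ?_
  obtain ⟨w, rfl⟩ := (vermaRel V).mkQ_surjective m
  change vermaMk V w ∈ _
  induction w using TensorProduct.induction_on with
  | zero => rw [map_zero]; exact zero_mem _
  | tmul u v =>
    rw [← smul_vermaMap]
    exact smul_mem_of_lieSubmodule _ u (LieSubmodule.subset_lieSpan ⟨v, rfl⟩)
  | add x y hx hy => rw [map_add]; exact add_mem (hx trivial) (hy trivial)

variable {V} {M : Type*} [AddCommGroup M] [Module ℂ M] [LieRingModule S2bar M]
  {f : V →ₗ[ℂ] M}

theorem range_eq_lieSpan {φ : ParabolicVerma V →ₗ⁅ℂ,S2bar⁆ M} (hφ : ∀ v, φ (vermaMap V v) = f v) :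
    φ.range = LieSubmodule.lieSpan ℂ S2bar (Set.range f) := by
  refine le_antisymm ?_ (LieSubmodule.lieSpan_le.mpr ?_)
  · rintro _ ⟨m, rfl⟩
    suffices h : ⊤ ≤ (LieSubmodule.lieSpan ℂ S2bar (Set.range f)).comap φ from h trivial
    rw [← lieSpan_range_vermaMap, LieSubmodule.lieSpan_le]
    rintro _ ⟨v, rfl⟩
    exact LieSubmodule.subset_lieSpan ⟨v, (hφ v).symm⟩
  · rintro _ ⟨v, rfl⟩
    exact ⟨vermaMap V v, hφ v⟩

variable [LieModule ℂ S2bar M]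

theorem IsParabolicMap.exists_lift (hf : IsParabolicMap f) :
    ∃ φ : ParabolicVerma V →ₗ⁅ℂ,S2bar⁆ M, ∀ v, φ (vermaMap V v) = f v := by
  let act : US2 →ₐ[ℂ] Module.End ℂ M :=
    UniversalEnvelopingAlgebra.lift ℂ (LieModule.toEnd ℂ S2bar M)
  let _ : Module US2 M := Module.compHom M act.toRingHom
  have ι_smul (x : S2bar) (m : M) : UniversalEnvelopingAlgebra.ι ℂ x • m = ⁅x, m⁆ :=
    LinearMap.congr_fun (UniversalEnvelopingAlgebra.lift_ι_apply ℂ _ x) m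
  have : IsScalarTower ℂ US2 M := ⟨fun c u m => LinearMap.congr_fun (map_smul act c u) m⟩
  let g : (US2 ⊗[ℂ] V) →ₗ[US2] M :=
    TensorProduct.AlgebraTensorModule.lift
      { toFun := fun u => u • f
        map_add' := fun a b => add_smul a b f
        map_smul' := fun a b => mul_smul a b f }
  have g_tmul (u : US2) (v : V) : g (u ⊗ₜ v) = u • f v := rfl
  have hker : vermaRel V ≤ LinearMap.ker g := by
    refine Submodule.span_le.mpr ?_
    rintro _ ⟨x, v, rfl⟩
    change g _ = 0
    rw [map_sub, g_tmul, g_tmul, one_smul, ι_smul, hf, sub_self]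
  let h : ParabolicVerma V →ₗ[US2] M := (vermaRel V).liftQ g hker
  refine ⟨{ h.restrictScalars ℂ with map_lie' := fun {x m} => ?_ }, fun v => ?_⟩
  · exact (map_smul h _ m).trans (ι_smul x (h m))
  · exact (g_tmul 1 v).trans (one_smul US2 (f v))

theorem IsParabolicMap.exists_quotient_equiv (hf : IsParabolicMap f)
    (hirr : LieModule.IsIrreducible ℂ S2bar (LieSubmodule.lieSpan ℂ S2bar (Set.range f))) :
    ∃ N : LieSubmodule ℂ S2bar (ParabolicVerma V),
      LieModule.IsIrreducible ℂ S2bar (ParabolicVerma V ⧸ N) ∧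
      Nonempty ((ParabolicVerma V ⧸ N) ≃ₗ⁅ℂ,S2bar⁆
        LieSubmodule.lieSpan ℂ S2bar (Set.range f)) := by
  obtain ⟨φ, hφ⟩ := hf.exists_lift
  rw [← range_eq_lieSpan hφ] at hirr ⊢
  exact ⟨φ.ker, (isIrreducible_congr (quotKerEquivRange φ)).mpr hirr, ⟨quotKerEquivRange φ⟩⟩

theorem eq_of_isIrreducible_quotient [LieModule ℂ gl2 V] [FiniteDimensional ℂ V]
    [LieModule.IsIrreducible ℂ gl2 V] {N N' : LieSubmodule ℂ S2bar (ParabolicVerma V)}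
    (hN : LieModule.IsIrreducible ℂ S2bar (ParabolicVerma V ⧸ N))
    (hN' : LieModule.IsIrreducible ℂ S2bar (ParabolicVerma V ⧸ N')) : N = N' :=
  (isParabolicMap_vermaMap V).isCoatom_unique (lieSpan_range_vermaMap V)
    (isCoatom_of_isIrreducible_quotient hN) (isCoatom_of_isIrreducible_quotient hN')

end Verma

section LocallyNilpotent

variable {M : Type*} [AddCommGroup M] [Module ℂ M] [LieRingModule S2bar M] [LieModule ℂ S2bar M]

theorem exists_mem_ne_zero_del_lie_eq_zero {N : LieSubmodule ℂ S2bar M}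
    (hdel : ∀ i, ∀ m ∈ N, ∃ k, (LieModule.toEnd ℂ S2bar M (del i) ^ k) m = 0) (hN : N ≠ ⊥) :
    ∃ m ∈ N, m ≠ 0 ∧ ∀ i, ⁅del i, m⁆ = 0 := by
  have hcomm : Commute (LieModule.toEnd ℂ S2bar M (del 0)) (LieModule.toEnd ℂ S2bar M (del 1)) := by
    rw [commute_iff_lie_eq, ← LieHom.map_lie, del_lie_del, map_zero]
  obtain ⟨m, hmN, hm0, h0, h1⟩ :=
    exists_mem_ne_zero_of_commute hcomm (N := N.toSubmodule) (hdel 0) (hdel 1)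
      (fun h => hN (LieSubmodule.toSubmodule_injective h)) (fun _ h => N.lie_mem h)
      (fun _ h => N.lie_mem h)
  exact ⟨m, hmN, hm0, Fin.forall_fin_two.mpr ⟨h0, h1⟩⟩

end LocallyNilpotent

section Tensor

variable {V : Type u} [AddCommGroup V] [Module ℂ V]

theorem exists_one_tmul_eq {w : A2 ⊗[ℂ] V}
    (hw : ∀ i, (MvPolynomial.pderiv i).toLinearMap.rTensor V w = 0) :
    ∃ v : V, (1 : A2) ⊗ₜ v = w := by
  classical
  let b := Module.Basis.ofVectorSpace ℂ V
  let e := TensorProduct.equivFinsuppOfBasisRight (M := A2) b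
  have coord_pderiv (i : Fin 2) (k) (w : A2 ⊗[ℂ] V) :
      e ((MvPolynomial.pderiv i).toLinearMap.rTensor V w) k = MvPolynomial.pderiv i (e w k) := by
    induction w using TensorProduct.induction_on with
    | zero => simp
    | tmul p v => simp [e]
    | add x y hx hy => simp only [map_add, Finsupp.add_apply, hx, hy]
  have coord_eq_C (k) : e w k = MvPolynomial.C (MvPolynomial.constantCoeff (e w k)) :=
    eq_C_of_pderiv_eq_zero fun i => by rw [← coord_pderiv, hw]; simp
  let s : _ →₀ ℂ := (e w).mapRange MvPolynomial.constantCoeff (map_zero _)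
  refine ⟨b.repr.symm s, e.injective (Finsupp.ext fun k => ?_)⟩
  rw [TensorProduct.equivFinsuppOfBasisRight_apply_tmul_apply, coord_eq_C]
  simp [s, MvPolynomial.smul_eq_C_mul]

theorem exists_rTensor_pderiv_pow_eq_zero (i : Fin 2) (w : A2 ⊗[ℂ] V) :
    ∃ n : ℕ, ((MvPolynomial.pderiv i).toLinearMap.rTensor V ^ n) w = 0 := by
  induction w using TensorProduct.induction_on with
  | zero => exact ⟨0, map_zero _⟩
  | tmul p v =>
    refine ⟨p.degreeOf i + 1, ?_⟩
    rw [LinearMap.rTensor_pow, LinearMap.rTensor_tmul, pderiv_pow_eq_zero (Nat.lt_succ_self _),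
      TensorProduct.zero_tmul]
  | add x y hx hy =>
    obtain ⟨n, hn⟩ := hx
    obtain ⟨m, hm⟩ := hy
    exact ⟨m + n, by
      rw [map_add, Module.End.pow_map_zero_of_le (Nat.le_add_left n m) hn,
        Module.End.pow_map_zero_of_le (Nat.le_add_right m n) hm, add_zero]⟩

variable [LieRingModule gl2 V] [LieModule ℂ gl2 V]

theorem tensorAct_del (i : Fin 2) :
    tensorAct V (del i : W2) = (MvPolynomial.pderiv i).toLinearMap.rTensor V := by
  refine TensorProduct.ext' fun p v => ?_
  rw [tensorAct_tmul, jac_del, LinearMap.rTensor_tmul]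
  simp [coe_del]

theorem exists_toEnd_del_pow_eq_zero (i : Fin 2) (w : T V) :
    ∃ n : ℕ, (LieModule.toEnd ℂ S2bar (T V) (del i) ^ n) w = 0 := by
  change ∃ n : ℕ, ((tensorAct V (del i : W2) : Module.End ℂ (A2 ⊗[ℂ] V)) ^ n) w = 0
  rw [tensorAct_del]
  exact exists_rTensor_pderiv_pow_eq_zero i w

variable (V)

/-- The map `V → T(A₂, V)`, `v ↦ 1 ⊗ v`. -/
noncomputable def tensorMap : V →ₗ[ℂ] T V := TensorProduct.mk ℂ A2 V 1

theorem isParabolicMap_tensorMap : IsParabolicMap (tensorMap V) := by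
  refine isParabolicMap_of_del_of_linear (fun i v => ?_) fun a v => ?_
  · change tensorAct V (del i : W2) (1 ⊗ₜ v) = 0
    rw [tensorAct_del, LinearMap.rTensor_tmul]
    simp
  · change tensorAct V (linear a : W2) (1 ⊗ₜ v) = 1 ⊗ₜ ⁅a, v⁆
    have ha : ⁅a, v⁆ = ∑ i, ∑ j, a i j • ⁅(Matrix.single i j 1 : gl2), v⁆ := by
      conv_lhs => rw [Matrix.matrix_eq_sum_single a]
      simp only [Fin.sum_univ_two, add_lie, ← smul_lie, Matrix.smul_single, smul_eq_mul, mul_one]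
    rw [tensorAct_tmul, ha]
    simp [coe_linear, jac_linearField, Fin.sum_univ_two, TensorProduct.tmul_add,
      ← MvPolynomial.algebraMap_eq, Algebra.algebraMap_eq_smul_one, TensorProduct.smul_tmul]

variable [LieModule.IsIrreducible ℂ gl2 V]

variable {V} in
theorem T1_le_of_ne_bot {N : LieSubmodule ℂ S2bar (T V)} (hN : N ≠ ⊥) : T1 V ≤ N := by
  obtain ⟨w, hwN, hw0, hw⟩ :=
    exists_mem_ne_zero_del_lie_eq_zero (fun i m _ => exists_toEnd_del_pow_eq_zero i m) hN
  obtain ⟨v, rfl⟩ := exists_one_tmul_eq (w := w) fun i => tensorAct_del (V := V) i ▸ hw i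
  refine (isParabolicMap_tensorMap V).lieSpan_le (v := v) hwN ?_
  rintro rfl
  exact hw0 (map_zero (tensorMap V))

theorem isAtom_T1 : IsAtom (T1 V) := by
  refine ⟨fun h => ?_, fun N hN => by_contra fun hN0 => hN.not_ge (T1_le_of_ne_bot hN0)⟩
  have := LieModule.nontrivial_of_isIrreducible ℂ gl2 V
  obtain ⟨v, hv⟩ := exists_ne (0 : V)
  have hmem : tensorMap V v ∈ T1 V := LieSubmodule.subset_lieSpan ⟨v, rfl⟩
  rw [h, LieSubmodule.mem_bot] at hmem
  exact hv (Module.FaithfullyFlat.tensorProduct_mk_injective (A := ℂ) (B := A2) V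
    (hmem.trans (map_zero (tensorMap V)).symm))

end Tensor

section Equivalence

variable {V : Type u} [AddCommGroup V] [Module ℂ V] [LieRingModule gl2 V] [LieModule ℂ gl2 V]
  [LieModule.IsIrreducible ℂ gl2 V]

instance : LieModule.IsIrreducible ℂ S2bar (T1 V) := isIrreducible_of_isAtom (isAtom_T1 V)

variable [FiniteDimensional ℂ V]
  {M : Type*} [AddCommGroup M] [Module ℂ M] [LieRingModule S2bar M] [LieModule ℂ S2bar M]
  [LieModule.IsIrreducible ℂ S2bar M] {f : V →ₗ[ℂ] M}

theorem IsParabolicMap.nonempty_equiv_T1 (hf : IsParabolicMap f) {v : V} (hv : f v ≠ 0) :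
    Nonempty (M ≃ₗ⁅ℂ,S2bar⁆ T1 V) := by
  have hgen : LieSubmodule.lieSpan ℂ S2bar (Set.range f) = ⊤ := lieSpan_range_eq_top hv
  obtain ⟨N, hN, ⟨e⟩⟩ := hf.exists_quotient_equiv <|
    hgen ▸ (isIrreducible_congr (LieModuleEquiv.ofTop ℂ S2bar M)).mpr inferInstance
  obtain ⟨N', hN', ⟨e'⟩⟩ := (isParabolicMap_tensorMap V).exists_quotient_equiv
    (inferInstanceAs (LieModule.IsIrreducible ℂ S2bar (T1 V)))
  obtain rfl := eq_of_isIrreducible_quotient hN hN'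
  rw [hgen] at e
  exact ⟨((LieModuleEquiv.ofTop ℂ S2bar M).symm.trans e.symm).trans e'⟩

end Equivalence

section Whittaker

theorem phi_zero (x : Delta2) : phi 0 x = 0 := by simp [phi]

variable {M : Type*} [AddCommGroup M] [Module ℂ M] [LieRingModule S2bar M] [LieModule ℂ S2bar M]

theorem mem_Wh_zero_iff {m : M} : m ∈ Wh M 0 ↔ ∀ i, ⁅del i, m⁆ = 0 := by
  refine ⟨fun h i => ?_, fun h x => ?_⟩
  · have hi := h ⟨del i, Submodule.subset_span ⟨i, rfl⟩⟩
    rwa [phi_zero, zero_smul] at hi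
  · have hker : Submodule.span ℂ (Set.range del) ≤
        LinearMap.ker ((LieModule.toEnd ℂ S2bar M : S2bar →ₗ[ℂ] Module.End ℂ M).flip m) := by
      rw [Submodule.span_le]
      rintro _ ⟨i, rfl⟩
      exact h i
    rw [phi_zero, zero_smul]
    exact hker x.2

theorem linear_lie_mem_Wh (a : gl2) {m : M} (hm : m ∈ Wh M 0) : ⁅linear a, m⁆ ∈ Wh M 0 := by
  rw [mem_Wh_zero_iff] at hm ⊢
  intro i
  rw [leibniz_lie, del_lie_linear, hm, lie_zero]
  simp [Fin.sum_univ_two, hm]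

/-- `Wh_0(M)` is a module over `gl₂ ≅ S̄₂(0)`, because `S̄₂(0)` normalizes `Δ₂`. -/
noncomputable instance : LieRingModule gl2 (Wh M 0) where
  bracket a m := ⟨⁅linear a, (m : M)⁆, linear_lie_mem_Wh a m.2⟩
  add_lie a b m := Subtype.ext <| (congrArg (⁅·, (m : M)⁆) (map_add linear a b)).trans <|
    add_lie (linear a) (linear b) (m : M)
  lie_add a m n := Subtype.ext <| lie_add (linear a) (m : M) n
  leibniz_lie a b m := Subtype.ext <| by
    change _ = ⁅linear ⁅a, b⁆, (m : M)⁆ + _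
    rw [LieHom.map_lie]
    exact leibniz_lie (linear a) (linear b) (m : M)

instance : LieModule ℂ gl2 (Wh M 0) where
  smul_lie c a m := Subtype.ext <| (congrArg (⁅·, (m : M)⁆) (map_smul linear c a)).trans <|
    smul_lie c (linear a) (m : M)
  lie_smul c a m := Subtype.ext <| lie_smul c (linear a) (m : M)

theorem isParabolicMap_subtype_Wh (K : LieSubmodule ℂ gl2 (Wh M 0)) :
    IsParabolicMap ((Wh M 0).subtype ∘ₗ K.toSubmodule.subtype : K →ₗ[ℂ] M) :=
  isParabolicMap_of_del_of_linear (fun i v => mem_Wh_zero_iff.mp v.1.2 i) fun _ _ => rfl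

theorem nontrivial_Wh [Nontrivial M] (h : IsOfType M 0) : Nontrivial (Wh M 0) := by
  obtain ⟨m, -, hm0, hm⟩ := exists_mem_ne_zero_del_lie_eq_zero (N := (⊤ : LieSubmodule ℂ S2bar M))
    (fun i m _ => by
      obtain ⟨k, hk⟩ := h m ⟨del i, Submodule.subset_span ⟨i, rfl⟩⟩
      rw [phi_zero, zero_smul, sub_zero] at hk
      exact ⟨k, hk⟩) top_ne_bot
  exact ⟨⟨m, mem_Wh_zero_iff.mpr hm⟩, 0, fun h0 => hm0 (congrArg Subtype.val h0)⟩

theorem exists_irreducible_lieSubmodule_Wh [Nontrivial M] (hM : InOmega M 0) :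
    ∃ K : LieSubmodule ℂ gl2 (Wh M 0),
      FiniteDimensional ℂ K ∧ LieModule.IsIrreducible ℂ gl2 K := by
  have := hM.finiteDimensional
  have := nontrivial_Wh hM.isOfType
  obtain ⟨K, hK, -⟩ := (eq_bot_or_exists_atom_le (⊤ : LieSubmodule ℂ gl2 (Wh M 0))).resolve_left
    top_ne_bot
  exact ⟨K, inferInstanceAs (FiniteDimensional ℂ K.toSubmodule), isIrreducible_of_isAtom hK⟩

theorem nonempty_equiv_T1_of_lieSubmodule_Wh [LieModule.IsIrreducible ℂ S2bar M]
    (K : LieSubmodule ℂ gl2 (Wh M 0)) [FiniteDimensional ℂ K] [LieModule.IsIrreducible ℂ gl2 K] :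
    Nonempty (M ≃ₗ⁅ℂ,S2bar⁆ T1 K) := by
  have := LieModule.nontrivial_of_isIrreducible ℂ gl2 K
  obtain ⟨k, hk⟩ := exists_ne (0 : K)
  exact (isParabolicMap_subtype_Wh K).nonempty_equiv_T1 (v := k) fun h =>
    hk (Subtype.ext (Subtype.ext h))

end Whittaker

end WhittakerS2

theorem proposition4p1 :
    (∀ (V : Type u) [AddCommGroup V] [Module ℂ V] [LieRingModule WhittakerS2.gl2 V]
      [LieModule ℂ WhittakerS2.gl2 V] [FiniteDimensional ℂ V]
      [LieModule.IsIrreducible ℂ WhittakerS2.gl2 V],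
      LieModule.IsIrreducible ℂ WhittakerS2.S2bar (WhittakerS2.T1 V) ∧
      ∃ N : LieSubmodule ℂ WhittakerS2.S2bar (WhittakerS2.ParabolicVerma V),
        LieModule.IsIrreducible ℂ WhittakerS2.S2bar (WhittakerS2.ParabolicVerma V ⧸ N) ∧
        (∀ N' : LieSubmodule ℂ WhittakerS2.S2bar (WhittakerS2.ParabolicVerma V),
          LieModule.IsIrreducible ℂ WhittakerS2.S2bar (WhittakerS2.ParabolicVerma V ⧸ N') →
            N' = N) ∧
        Nonempty ((WhittakerS2.ParabolicVerma V ⧸ N) ≃ₗ⁅ℂ, WhittakerS2.S2bar⁆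
          WhittakerS2.T1 V)) ∧
    (∀ (M : Type u) [AddCommGroup M] [Module ℂ M] [LieRingModule WhittakerS2.S2bar M]
      [LieModule ℂ WhittakerS2.S2bar M] [LieModule.IsIrreducible ℂ WhittakerS2.S2bar M],
      WhittakerS2.InOmega M 0 →
      ∃ (V : Type u) (_ : AddCommGroup V) (_ : Module ℂ V) (_ : LieRingModule WhittakerS2.gl2 V)
        (_ : LieModule ℂ WhittakerS2.gl2 V),
        FiniteDimensional ℂ V ∧ LieModule.IsIrreducible ℂ WhittakerS2.gl2 V ∧
        Nonempty (M ≃ₗ⁅ℂ, WhittakerS2.S2bar⁆ WhittakerS2.T1 V)) := by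
  open WhittakerS2 in
  refine ⟨fun V _ _ _ _ _ _ => ?_, fun M _ _ _ _ _ hM => ?_⟩
  · obtain ⟨N, hN, he⟩ := (isParabolicMap_tensorMap V).exists_quotient_equiv
      (inferInstanceAs (LieModule.IsIrreducible ℂ S2bar (T1 V)))
    exact ⟨inferInstance, N, hN, fun N' hN' => eq_of_isIrreducible_quotient hN' hN, he⟩
  · have := LieModule.nontrivial_of_isIrreducible ℂ S2bar M
    obtain ⟨K, hfin, hK⟩ := exists_irreducible_lieSubmodule_Wh hM
    exact ⟨K, inferInstance, inferInstance, inferInstance, inferInstance, hfin, hK,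
      nonempty_equiv_T1_of_lieSubmodule_Wh K⟩
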